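/- For a finite simple graph $G$, a $k$-coloring is a (not necessarily proper) vertex coloring that uses exactly $k$ colors, and a coloring is distinguishing if the identity is the only automorphism of $G$ preserving it. The distinguishing threshold $\theta(G)$ is the least positive integer $t$ such that for every $k\ge t$ every $k$-coloring of $G$ is distinguishing. A graph is prime (with respect to the Cartesian product $\square$) if it has at least two vertices and is not isomorphic to a Cartesian product of two graphs both non-isomorphic to it. The Cartesian power $G^k$ is the Cartesian product of $k$ copies of $G$, and $|G|$ is the number of vertices of $G$. Theorem. Let $G$ be a finite connected prime graph and let $k\ge 2$ be an integer. Then $$\theta(G^k)=|G|^{k-1}\cdot\max\left\{\frac{|G|+1}{2},\ \theta(G)-1\right\}+1.$$ -/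

import Mathlib

/-- The `k`-th Cartesian power of a graph `G`: vertices are `k`-tuples of vertices of `G`, and two
tuples are adjacent when they are adjacent in `G` in one coordinate and agree in all the others. -/
def SimpleGraph.cartesianPower {V : Type*} (G : SimpleGraph V) (k : ℕ) :
    SimpleGraph (Fin k → V) where
  Adj x y := ∃ i, G.Adj (x i) (y i) ∧ ∀ j, j ≠ i → x j = y j
  symm := ⟨fun _ _ ⟨i, hi, h⟩ => ⟨i, hi.symm, fun j hj => (h j hj).symm⟩⟩
  loopless := ⟨fun _ ⟨_, hi, _⟩ => hi.ne rfl⟩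

/-- A nontrivial graph is prime if it is not the Cartesian product of two graphs
that are both non-isomorphic to it. -/
def SimpleGraph.IsCartesianPrime.{u} {V : Type u} (G : SimpleGraph V) : Prop :=
  Nontrivial V ∧
    ∀ (A B : Type u) (H : SimpleGraph A) (K : SimpleGraph B),
      Nonempty (G ≃g SimpleGraph.boxProd H K) → Nonempty (G ≃g H) ∨ Nonempty (G ≃g K)

/-- A vertex coloring is distinguishing if the identity is the only automorphism preserving it.
(Colorings are arbitrary functions on the vertices, not proper colorings.) -/
def SimpleGraph.IsDistinguishing {V C : Type*} (G : SimpleGraph V) (c : V → C) : Prop :=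
  ∀ φ : G ≃g G, (∀ v, c (φ v) = c v) → φ = SimpleGraph.Iso.refl

/-- The distinguishing threshold: the least positive `t` such that for every `k ≥ t` every vertex
coloring using exactly `k` colors is distinguishing. For finite `V` every `t > |V|` qualifies. -/
noncomputable def SimpleGraph.distinguishingThreshold {V : Type*} (G : SimpleGraph V) : ℕ :=
  sInf {t : ℕ | 1 ≤ t ∧
    ∀ k, t ≤ k → ∀ c : V → Fin k, Function.Surjective c → G.IsDistinguishing c}

/-! The threshold is one more than the largest number of colors in a coloring preserved by a
nontrivial automorphism (or 1 if there is none), so such automorphisms of the power must be known.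
By `IsCartesianPrime.exists_apply_eq` they permute coordinates and act coordinatewise: a line is
sent to a convex copy of `G`, which primeness forces into a single line, and line directions then
agree at all vertices. If coordinates move, at most `|V|^(k-1)` tuples are fixed, so at most half of
`|V|^k + |V|^(k-1)` colors occur. Otherwise some coordinate carries a nontrivial automorphism `α` of
`G`; colors are bounded by `|V|^(k-1)` times the number of cycles of `α`, which is below the
threshold of `G`. Swapping two coordinates, and lifting an optimal coloring of `G`, attain the two
bounds. -/

namespace SimpleGraph

open Function

/-! ### Distances and geodesics in Cartesian powers. -/

section Distance

theorem cartesianPower_adj_update {V : Type*} {G : SimpleGraph V} {k : ℕ} {x : Fin k → V}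
    {i : Fin k} {v : V} (h : G.Adj (x i) v) : (G.cartesianPower k).Adj x (update x i v) :=
  ⟨i, by simpa using h, fun j hj => by simp [hj]⟩

theorem cartesianPower_adj_iff_of_eq_off {V : Type*} {G : SimpleGraph V} {k : ℕ}
    {x y : Fin k → V} {i : Fin k} (h : ∀ l, l ≠ i → x l = y l) :
    (G.cartesianPower k).Adj x y ↔ G.Adj (x i) (y i) := by
  constructor
  · rintro ⟨j, hj, -⟩
    by_cases hji : j = i
    · exact hji ▸ hj
    · exact absurd (h j hji) hj.ne
  · exact fun hi => ⟨i, hi, h⟩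

theorem Connected.exists_adj_dist_add_one_eq {V : Type*} {G : SimpleGraph V} (hG : G.Connected)
    {u v : V} (huv : u ≠ v) : ∃ w, G.Adj u w ∧ G.dist w v + 1 = G.dist u v := by
  obtain ⟨p, hp⟩ := hG.exists_walk_length_eq_dist u v
  cases p with
  | nil => exact absurd rfl huv
  | @cons _ w _ h q =>
    refine ⟨w, h, ?_⟩
    have h1 : G.dist w v ≤ q.length := dist_le q
    have h2 : G.dist u v ≤ G.dist u w + G.dist w v := hG.dist_triangle
    have h3 : G.dist u w = 1 := dist_eq_one_iff_adj.2 h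
    rw [Walk.length_cons] at hp
    omega

theorem sum_dist_le_length {V : Type*} {G : SimpleGraph V} (hG : G.Connected) {k : ℕ}
    {x y : Fin k → V} (p : (G.cartesianPower k).Walk x y) :
    ∑ i, G.dist (x i) (y i) ≤ p.length := by
  induction p with
  | nil => simp
  | @cons x z y h p ih =>
    obtain ⟨i, hi, hz⟩ := id h
    have h1 : ∑ l, G.dist (x l) (y l) ≤ ∑ l, ((if l = i then 1 else 0) + G.dist (z l) (y l)) := by
      refine Finset.sum_le_sum fun l _ => ?_
      split_ifs with hl
      · subst hl
        rw [← dist_eq_one_iff_adj.2 hi]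
        exact hG.dist_triangle
      · rw [hz l hl, zero_add]
    rw [Finset.sum_add_distrib, Finset.sum_ite_eq' Finset.univ i] at h1
    simp only [Finset.mem_univ, if_true] at h1
    rw [Walk.length_cons]
    omega

theorem exists_walk_length_eq_sum_dist {V : Type*} {G : SimpleGraph V} (hG : G.Connected) {k : ℕ}
    (x y : Fin k → V) :
    ∃ p : (G.cartesianPower k).Walk x y, p.length = ∑ i, G.dist (x i) (y i) := by
  induction hn : ∑ i, G.dist (x i) (y i) generalizing x with
  | zero =>
    obtain rfl : x = y := by
      funext i
      have := (Finset.sum_eq_zero_iff.1 hn) i (Finset.mem_univ i)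
      exact hG.dist_eq_zero_iff.1 this
    exact ⟨.nil, rfl⟩
  | succ n ih =>
    obtain ⟨i, hi⟩ : ∃ i, x i ≠ y i := by
      by_contra! h
      simp [h] at hn
    obtain ⟨w, hw, hd⟩ := hG.exists_adj_dist_add_one_eq hi
    have hsum : ∑ l, G.dist (update x i w l) (y l) = n := by
      rw [← Finset.add_sum_erase _ _ (Finset.mem_univ i)] at hn ⊢
      have : ∑ l ∈ Finset.univ.erase i, G.dist (update x i w l) (y l) =
          ∑ l ∈ Finset.univ.erase i, G.dist (x l) (y l) :=
        Finset.sum_congr rfl fun l hl => by rw [update_of_ne (Finset.ne_of_mem_erase hl)]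
      rw [this, update_self]
      omega
    obtain ⟨p, hp⟩ := ih _ hsum
    exact ⟨.cons (cartesianPower_adj_update hw) p, by simp [hp]⟩

theorem dist_cartesianPower {V : Type*} {G : SimpleGraph V} (hG : G.Connected) {k : ℕ}
    (x y : Fin k → V) : (G.cartesianPower k).dist x y = ∑ i, G.dist (x i) (y i) := by
  obtain ⟨p, hp⟩ := exists_walk_length_eq_sum_dist hG x y
  refine le_antisymm (hp ▸ dist_le p) ?_
  obtain ⟨q, hq⟩ := p.reachable.exists_walk_length_eq_dist
  exact hq ▸ sum_dist_le_length hG q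

theorem connected_cartesianPower {V : Type*} {G : SimpleGraph V} (hG : G.Connected) (k : ℕ) :
    (G.cartesianPower k).Connected := by
  have := hG.nonempty
  exact ⟨fun x y => (exists_walk_length_eq_sum_dist hG x y).choose.reachable⟩

theorem Iso.dist_apply {V W : Type*} {G : SimpleGraph V} {H : SimpleGraph W} (hG : G.Connected)
    (hH : H.Connected) (φ : G ≃g H) (x y : V) : H.dist (φ x) (φ y) = G.dist x y := by
  refine le_antisymm ?_ ?_
  · obtain ⟨p, hp⟩ := hG.exists_walk_length_eq_dist x y
    rw [← hp, ← Walk.length_map φ.toHom p]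
    exact dist_le _
  · obtain ⟨p, hp⟩ := hH.exists_walk_length_eq_dist (φ x) (φ y)
    have := dist_le (p.map φ.symm.toHom)
    rw [Walk.length_map, hp] at this
    simpa using this

theorem dist_update_add_dist_update {V : Type*} {G : SimpleGraph V} (hG : G.Connected) {k : ℕ}
    (x y : Fin k → V) (j : Fin k) :
    (G.cartesianPower k).dist x (update x j (y j)) + (G.cartesianPower k).dist (update x j (y j)) y
      = (G.cartesianPower k).dist x y := by
  simp only [dist_cartesianPower hG, ← Finset.sum_add_distrib]
  refine Finset.sum_congr rfl fun l _ => ?_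
  by_cases hl : l = j
  · subst hl; simp
  · simp [hl]

/-- Lines of a Cartesian power are geodesically convex. -/
theorem eq_of_dist_add_dist_eq {V : Type*} {G : SimpleGraph V} (hG : G.Connected) {k : ℕ}
    {x y z : Fin k → V} (h : (G.cartesianPower k).dist x z + (G.cartesianPower k).dist z y =
      (G.cartesianPower k).dist x y) {l : Fin k} (hl : x l = y l) : z l = x l := by
  simp only [dist_cartesianPower hG, ← Finset.sum_add_distrib] at h
  have := (Finset.sum_eq_sum_iff_of_le fun i _ => hG.dist_triangle).1 h.symm l (Finset.mem_univ l)
  rw [← hl, dist_self] at this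
  exact (hG.dist_eq_zero_iff.1 (Nat.eq_zero_of_add_eq_zero_right this.symm)).symm

end Distance

/-! ### Primeness and images of lines. -/

section PrimeFactor

/-- By `hbox`, the range of `f` is the full product of its `j`-th projection `A` and a slice `B`, so
`G` is a box product; counting vertices, the factor not isomorphic to `G` is a point. -/
theorem IsCartesianPrime.const_off_or_const {V : Type*} [Finite V] {G : SimpleGraph V}
    (hprime : G.IsCartesianPrime) {k : ℕ} {f : V → Fin k → V} (hinj : Injective f)
    (hadj : ∀ v w, (G.cartesianPower k).Adj (f v) (f w) ↔ G.Adj v w)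
    (hbox : ∀ v w j, ∃ u, f u = update (f v) j (f w j)) (j : Fin k) :
    (∀ v w, ∀ l, l ≠ j → f v l = f w l) ∨ ∀ v w, f v j = f w j := by
  obtain ⟨hV, hprime⟩ := hprime
  obtain ⟨v₀⟩ := hV.to_nonempty
  let A : Set V := Set.range fun v => f v j
  let B : Set (Fin k → V) := {x | x ∈ Set.range f ∧ x j = f v₀ j}
  let F : V → A × B := fun v => (⟨f v j, v, rfl⟩, ⟨update (f v) j (f v₀ j), by
    obtain ⟨u, hu⟩ := hbox v v₀ j
    exact ⟨⟨u, hu⟩, by simp⟩⟩)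
  have hoff : ∀ {v w}, update (f v) j (f v₀ j) = update (f w) j (f v₀ j) →
      ∀ l, l ≠ j → f v l = f w l := fun h l hl => by simpa [hl] using congrFun h l
  have hF : Bijective F := by
    constructor
    · intro v w h
      have h1 : f v j = f w j := congrArg (fun p => (p.1 : V)) h
      have h2 : update (f v) j (f v₀ j) = update (f w) j (f v₀ j) :=
        congrArg (fun p => (p.2 : Fin k → V)) h
      refine hinj (funext fun l => ?_)
      by_cases hl : l = j
      · exact hl ▸ h1
      · exact hoff h2 l hl
    · rintro ⟨⟨_, w, rfl⟩, ⟨_, ⟨u, rfl⟩, hu⟩⟩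
      obtain ⟨t, ht⟩ := hbox u w j
      refine ⟨t, Prod.ext (Subtype.ext ?_) (Subtype.ext ?_)⟩
      · simp [F, ht]
      · simp [F, ht, ← hu]
  have hFadj : ∀ v w, (boxProd (G.induce A) ((G.cartesianPower k).induce B)).Adj (F v) (F w) ↔
      G.Adj v w := by
    intro v w
    rw [← hadj, boxProd_adj]
    simp only [F, comap_adj, Embedding.subtype_apply, Subtype.mk.injEq]
    constructor
    · rintro (⟨h1, h2⟩ | ⟨⟨i, hi, h⟩, h2⟩)
      · exact ⟨j, h1, hoff h2⟩
      · have hij : i ≠ j := by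
          rintro rfl
          simp at hi
        refine ⟨i, by simpa [hij] using hi, fun l hl => ?_⟩
        by_cases hlj : l = j
        · exact hlj ▸ congrArg Subtype.val h2
        · simpa [hlj] using h l hl
    · rintro ⟨i, hi, h⟩
      by_cases hij : i = j
      · subst hij
        refine Or.inl ⟨hi, funext fun l => ?_⟩
        by_cases hl : l = i
        · subst hl; simp
        · simp [hl, h l hl]
      · refine Or.inr ⟨⟨i, by simpa [hij] using hi, fun l hl => ?_⟩, Subtype.ext (h j (Ne.symm hij))⟩
        by_cases hlj : l = j
        · subst hlj; simp
        · simp [hlj, h l hl]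
  have hcard : Nat.card V = Nat.card A * Nat.card B := by
    rw [Nat.card_congr (Equiv.ofBijective F hF), Nat.card_prod]
  have hpos : 0 < Nat.card V := Nat.card_pos
  rcases hprime A B (G.induce A) ((G.cartesianPower k).induce B)
    ⟨⟨Equiv.ofBijective F hF, hFadj _ _⟩⟩ with ⟨⟨e⟩⟩ | ⟨⟨e⟩⟩
  · left
    rw [← Nat.card_congr e.toEquiv] at hcard
    have hB : Nat.card B = 1 := Nat.eq_of_mul_eq_mul_left hpos (by omega)
    have := (Nat.card_eq_one_iff_unique.1 hB).1
    exact fun v w => hoff (congrArg Subtype.val (Subsingleton.elim (F v).2 (F w).2))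
  · right
    rw [← Nat.card_congr e.toEquiv] at hcard
    have hA : Nat.card A = 1 := Nat.eq_of_mul_eq_mul_right hpos (by omega)
    have := (Nat.card_eq_one_iff_unique.1 hA).1
    exact fun v w => congrArg Subtype.val (Subsingleton.elim (F v).1 (F w).1)

theorem IsCartesianPrime.exists_const_off {V : Type*} [Finite V] {G : SimpleGraph V}
    (hprime : G.IsCartesianPrime) {k : ℕ} {f : V → Fin k → V} (hinj : Injective f)
    (hadj : ∀ v w, (G.cartesianPower k).Adj (f v) (f w) ↔ G.Adj v w)
    (hbox : ∀ v w j, ∃ u, f u = update (f v) j (f w j)) :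
    ∃ j, ∀ v w, ∀ l, l ≠ j → f v l = f w l := by
  by_contra! hcon
  obtain ⟨v, w, hvw⟩ := hprime.1.exists_pair_ne
  refine hvw (hinj (funext fun j => ?_))
  rcases hprime.const_off_or_const hinj hadj hbox j with h | h
  · obtain ⟨v', w', l, hl, hne⟩ := hcon j
    exact absurd (h v' w' l hl) hne
  · exact h v w

/-- An automorphism of a power of a connected prime graph maps lines to lines. -/
theorem IsCartesianPrime.exists_line_map {V : Type*} [Finite V] {G : SimpleGraph V}
    (hG : G.Connected) (hprime : G.IsCartesianPrime) {k : ℕ}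
    (φ : G.cartesianPower k ≃g G.cartesianPower k) (a : Fin k → V) (i : Fin k) :
    ∃ j, ∀ v l, l ≠ j → φ (update a i v) l = φ a l := by
  have hGk := connected_cartesianPower hG k
  obtain ⟨j, hj⟩ := hprime.exists_const_off (f := fun v => φ (update a i v))
    (φ.injective.comp (update_injective a i))
    (fun v w => by
      rw [φ.map_adj_iff, cartesianPower_adj_iff_of_eq_off (i := i) fun l hl => by simp [hl]]
      simp)
    (fun v w j => by
      -- The mixed tuple lies on a geodesic between two image points, so its preimage `z` lies
      -- between two points of the original line, hence on it.
      set z := φ.symm (update (φ (update a i v)) j (φ (update a i w) j)) with hz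
      have h := dist_update_add_dist_update hG (φ (update a i v)) (φ (update a i w)) j
      rw [show update (φ (update a i v)) j (φ (update a i w) j) = φ z by simp [hz],
        Iso.dist_apply hGk hGk, Iso.dist_apply hGk hGk, Iso.dist_apply hGk hGk] at h
      refine ⟨z i, ?_⟩
      have : update a i (z i) = z := by
        funext l
        by_cases hl : l = i
        · subst hl; simp
        · rw [eq_of_dist_add_dist_eq hG h (l := l) (by simp [hl])]
          simp [hl]
      simp only [this]
      simp [hz])
  exact ⟨j, fun v l hl => by simpa using hj v (a i) l hl⟩

end PrimeFactor

/-! ### Consistency of line directions. -/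

section LineMaps

theorem _root_.Function.eq_of_forall_update_eq {ι V β : Type*} [Finite ι] [DecidableEq ι]
    (f : (ι → V) → β) (P : ι → Prop) (hf : ∀ i, P i → ∀ x v, f (update x i v) = f x)
    {x y : ι → V} (hxy : ∀ i, ¬ P i → x i = y i) : f x = f y := by
  classical
  have := Fintype.ofFinite ι
  have key : ∀ s : Finset ι, f (s.piecewise y x) = f x := by
    intro s
    induction s using Finset.induction_on with
    | empty => simp
    | insert j s _ ih =>
      rw [Finset.piecewise_insert]
      by_cases hj : P j
      · rw [hf j hj, ih]
      · rw [← ih]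
        congr 1
        rw [← hxy j hj]
        funext l
        by_cases hl : l = j
        · subst hl; by_cases hs : l ∈ s <;> simp [hs, hxy l hj]
        · simp [hl]
  simpa using (key Finset.univ).symm

variable {V : Type*} [Finite V] [Nontrivial V] {k : ℕ} {φ : (Fin k → V) → Fin k → V}
  {π : (Fin k → V) → Fin k → Fin k}

theorem lineDirection_injective (hφ : Injective φ)
    (hπ : ∀ a i v l, l ≠ π a i → φ (update a i v) l = φ a l) (a : Fin k → V) :
    Injective (π a) := by
  intro i j hij
  by_contra hne
  have hinj : Injective fun v => φ (update a i v) (π a i) := by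
    intro v w h
    refine update_injective a i (hφ (funext fun l => ?_))
    by_cases hl : l = π a i
    · exact hl ▸ h
    · rw [hπ a i v l hl, hπ a i w l hl]
  obtain ⟨v, hv⟩ := exists_ne (a j)
  obtain ⟨w, hw⟩ := (Finite.surjective_of_injective hinj) (φ (update a j v) (π a i))
  have : update a i w = update a j v := by
    refine hφ (funext fun l => ?_)
    by_cases hl : l = π a i
    · exact hl ▸ hw
    · rw [hπ a i w l hl, hπ a j v l (hij ▸ hl)]
  have := congrFun this j
  rw [update_of_ne (Ne.symm hne), update_self] at this
  exact hv this.symm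

/-- Consider the square on `a` with sides in directions `i` and `j`. If the direction of `j` changed
to `q` across it, the opposite `i`-side would also have to move `q`. Then three sides preserve
coordinate `π a i`, while the fourth changes it. -/
theorem lineDirection_update (hφ : Injective φ)
    (hπ : ∀ a i v l, l ≠ π a i → φ (update a i v) l = φ a l) (a : Fin k → V) (i : Fin k) (v : V) :
    π (update a i v) = π a := by
  rcases eq_or_ne v (a i) with rfl | hv
  · simp
  have hne : ∀ {b : Fin k → V} {j w}, w ≠ b j → φ (update b j w) (π b j) ≠ φ b (π b j) := by
    intro b j w hw h
    refine hw ?_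
    have : update b j w = b := hφ (funext fun l => ?_)
    · simpa using congrFun this j
    · by_cases hl : l = π b j
      · exact hl ▸ h
      · exact hπ b j w l hl
  have hi : π (update a i v) i = π a i := by
    by_contra h
    have h1 := hne (b := update a i v) (j := i) (w := a i) (by simpa using hv.symm)
    rw [update_idem, update_eq_self] at h1
    exact h1 (hπ a i v _ h).symm
  funext j
  by_cases hji : j = i
  · rw [hji, hi]
  by_contra hq
  obtain ⟨u, hu⟩ := exists_ne (a j)
  have hcomm : update (update a i v) j u = update (update a j u) i v := update_comm (Ne.symm hji) ..
  have hqp : π (update a i v) j ≠ π a i := fun h =>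
    hji (lineDirection_injective hφ hπ (update a i v) (h.trans hi.symm))
  have hpq : π a i ≠ π a j := fun h => hji (lineDirection_injective hφ hπ a h).symm
  have h1 := hne (b := update a i v) (j := j) (w := u) (by simpa [hji] using hu)
  rw [hcomm, hπ a i v _ hqp, ← hπ a j u _ hq] at h1
  have hp' : π (update a i v) j = π (update a j u) i := by
    by_contra h
    exact h1 (hπ (update a j u) i v _ h)
  refine hne hv ?_
  rw [← hπ (update a i v) j u _ (Ne.symm hqp), hcomm, hπ (update a j u) i v _ (hp' ▸ Ne.symm hqp),
    hπ a j u _ hpq]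

theorem exists_eq_apply_of_lines (hφ : Injective φ)
    (hπ : ∀ a i, ∃ j, ∀ v l, l ≠ j → φ (update a i v) l = φ a l) :
    ∃ (σ : Fin k → Fin k) (f : Fin k → V → V), Injective σ ∧ ∀ x i, φ x (σ i) = f i (x i) := by
  choose π hπ using hπ
  obtain ⟨v₀⟩ := ‹Nontrivial V›.to_nonempty
  have hconst : ∀ x, π x = π fun _ => v₀ := fun x =>
    eq_of_forall_update_eq π (fun _ => True) (fun i _ x v => lineDirection_update hφ hπ x i v)
      (by simp)
  refine ⟨π fun _ => v₀, fun i v => φ (fun _ => v) (π (fun _ => v₀) i),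
    lineDirection_injective hφ hπ _, fun x i => ?_⟩
  refine eq_of_forall_update_eq (fun x => φ x (π (fun _ => v₀) i)) (fun j => j ≠ i)
    (fun j hj x v => hπ x j v _ fun h => ?_) (by simp)
  rw [hconst x] at h
  exact hj (lineDirection_injective hφ hπ _ h).symm

end LineMaps

/-- Automorphisms of a power of a connected prime graph permute the coordinates and act
coordinatewise. -/
theorem IsCartesianPrime.exists_apply_eq {V : Type*} [Finite V] {G : SimpleGraph V}
    (hG : G.Connected) (hprime : G.IsCartesianPrime) {k : ℕ}
    (φ : G.cartesianPower k ≃g G.cartesianPower k) :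
    ∃ (σ : Fin k → Fin k) (f : Fin k → V → V), Injective σ ∧ ∀ x i, φ x (σ i) = f i (x i) := by
  have := hprime.1
  exact exists_eq_apply_of_lines φ.injective fun a i => exists_line_map hG hprime φ a i

/-! ### The threshold and invariant colorings. -/

section Threshold

variable {V : Type*} [Finite V] {G : SimpleGraph V}

theorem distinguishingThreshold_mem (G : SimpleGraph V) :
    G.distinguishingThreshold ∈ {t : ℕ | 1 ≤ t ∧
      ∀ k, t ≤ k → ∀ c : V → Fin k, Surjective c → G.IsDistinguishing c} := by
  refine Nat.sInf_mem ⟨Nat.card V + 1, by omega, fun k hk c hc => ?_⟩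
  have := Nat.card_le_card_of_surjective c hc
  rw [Nat.card_fin] at this
  omega

theorem card_lt_distinguishingThreshold {C : Type*} {c : V → C} (hc : Surjective c)
    {φ : G ≃g G} (hφ : φ ≠ Iso.refl) (h : ∀ v, c (φ v) = c v) :
    Nat.card C < G.distinguishingThreshold := by
  have : Finite C := Finite.of_surjective c hc
  by_contra! hle
  let e := Finite.equivFin C
  exact hφ ((distinguishingThreshold_mem G).2 _ hle (e ∘ c) (e.surjective.comp hc) φ
    fun v => congrArg e (h v))

theorem exists_invariant_coloring {V : Type*} {G : SimpleGraph V}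
    (h : 2 ≤ G.distinguishingThreshold) :
    ∃ m, G.distinguishingThreshold ≤ m + 1 ∧ ∃ c : V → Fin m, Surjective c ∧
      ∃ φ : G ≃g G, φ ≠ Iso.refl ∧ ∀ v, c (φ v) = c v := by
  have hnot := Nat.notMem_of_lt_sInf (s := {t : ℕ | 1 ≤ t ∧
    ∀ k, t ≤ k → ∀ c : V → Fin k, Surjective c → G.IsDistinguishing c})
    (m := G.distinguishingThreshold - 1) (Nat.sub_lt (by omega) one_pos)
  simp only [Set.mem_ofPred_eq, IsDistinguishing] at hnot
  push Not at hnot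
  obtain ⟨m, hm, c, hc, φ, hφ, hne⟩ := hnot (by omega)
  exact ⟨m, by omega, c, hc, φ, hne, hφ⟩

end Threshold

/-! ### Automorphisms of powers and upper bounds on colors. -/

section Automorphisms

variable {V : Type*} {G : SimpleGraph V} {k : ℕ}

/-- The automorphism of a Cartesian power induced by an automorphism of the base graph acting on a
single coordinate. -/
def Iso.cartesianPowerUpdate (α : G ≃g G) (i : Fin k) :
    G.cartesianPower k ≃g G.cartesianPower k where
  toFun x := update x i (α (x i))
  invFun x := update x i (α.symm (x i))
  left_inv x := by simp
  right_inv x := by simp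
  map_rel_iff' {x y} := by
    refine exists_congr fun j => ?_
    by_cases hj : j = i
    · subst hj
      refine and_congr (by simp [α.map_adj_iff]) (forall₂_congr fun l hl => by simp [hl])
    · refine and_congr (by simp [hj]) (forall₂_congr fun l hl => ?_)
      by_cases hli : l = i
      · subst hli; simp
      · simp [hli]

@[simp]
theorem Iso.cartesianPowerUpdate_apply (α : G ≃g G) (i : Fin k) (x : Fin k → V) :
    α.cartesianPowerUpdate i x = update x i (α (x i)) := rfl

/-- The automorphism of a Cartesian power induced by a permutation of the coordinates. -/
def cartesianPowerReindex (G : SimpleGraph V) (σ : Equiv.Perm (Fin k)) :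
    G.cartesianPower k ≃g G.cartesianPower k where
  toEquiv := σ.arrowCongr (Equiv.refl V)
  map_rel_iff' {x y} := by
    refine (σ.symm.exists_congr_left).trans (exists_congr fun i => ?_)
    refine and_congr (by simp) ?_
    refine (σ.symm.forall_congr_left).trans (forall_congr' fun l => ?_)
    simp

@[simp]
theorem cartesianPowerReindex_apply (G : SimpleGraph V) (σ : Equiv.Perm (Fin k)) (x : Fin k → V)
    (i : Fin k) : G.cartesianPowerReindex σ x i = x (σ.symm i) := rfl

theorem card_funSplit (V : Type*) [Finite V] {k : ℕ} (i : Fin k) :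
    Nat.card ({l // l ≠ i} → V) = Nat.card V ^ (k - 1) := by
  rw [Nat.card_fun]
  simp

/-- For a representative `s a` of each color, `f (s a)` is a second vertex of that color unless `s
a` is fixed, in which case the fixed point is counted instead. -/
theorem two_mul_card_le_card_add_card_fixedPoints {X C : Type*} [Finite X] {f : X → X} {c : X → C}
    (hc : Surjective c) (h : ∀ x, c (f x) = c x) :
    2 * Nat.card C ≤ Nat.card X + Nat.card (fixedPoints f) := by
  classical
  let s := surjInv hc
  have hs : ∀ a, c (s a) = a := surjInv_eq hc
  have : Injective (Sum.elim (fun a => Sum.inl (s a)) fun a =>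
      if hf : f (s a) = s a then Sum.inr (⟨s a, hf⟩ : fixedPoints f) else Sum.inl (f (s a)) :
      C ⊕ C → X ⊕ fixedPoints f) := by
    have hsi : Injective s := injective_surjInv hc
    rintro (a | a) (b | b) hab
    · simpa using hsi (Sum.inl_injective hab)
    · simp only [Sum.elim_inl, Sum.elim_inr] at hab
      split_ifs at hab with hf
      have h1 := Sum.inl_injective hab
      have h2 := congrArg c h1
      rw [h, hs, hs] at h2
      exact absurd (h2 ▸ h1.symm) hf
    · simp only [Sum.elim_inl, Sum.elim_inr] at hab
      split_ifs at hab with hf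
      have h1 := Sum.inl_injective hab
      have h2 := congrArg c h1
      rw [h, hs, hs] at h2
      exact absurd (h2 ▸ h1) hf
    · simp only [Sum.elim_inr] at hab
      congr 1
      split_ifs at hab with hf hg
      · exact hsi (congrArg Subtype.val (Sum.inr_injective hab))
      · have h2 := congrArg c (Sum.inl_injective hab)
        rwa [h, h, hs, hs] at h2
  have hC : Finite C := Finite.of_surjective c hc
  have := Nat.card_le_card_of_injective _ this
  rw [Nat.card_sum, Nat.card_sum] at this
  omega

theorem card_fixedPoints_le {V : Type*} [Finite V] {k : ℕ} {φ : (Fin k → V) → Fin k → V}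
    {i j : Fin k} (hij : i ≠ j) {f : V → V} (h : ∀ x, φ x j = f (x i)) :
    Nat.card (fixedPoints φ) ≤ Nat.card V ^ (k - 1) := by
  rw [← card_funSplit V j]
  refine Nat.card_le_card_of_injective
    (fun x : fixedPoints φ => fun l : {l // l ≠ j} => (x : Fin k → V) l) fun x y hxy => ?_
  refine Subtype.ext (funext fun l => ?_)
  have hl : ∀ l, l ≠ j → (x : Fin k → V) l = (y : Fin k → V) l :=
    fun l hl => congrFun hxy ⟨l, hl⟩
  by_cases hlj : l = j
  · subst hlj
    rw [← congrFun x.2.eq l, ← congrFun y.2.eq l, h, h, hl i hij]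
  · exact hl l hlj

/-- Iterating `φ` keeps the color and moves coordinate `i` along its `α`-cycle, so each color
appears on a tuple whose `i`-th entry is a chosen cycle representative. -/
theorem card_le_of_coordinate_action {V C : Type*} [Finite V] {k : ℕ}
    {φ : (Fin k → V) → Fin k → V} {i : Fin k} {α : Equiv.Perm V} (h : ∀ x, φ x i = α (x i))
    {c : (Fin k → V) → C} (hc : Surjective c) (hφ : ∀ x, c (φ x) = c x) :
    Nat.card C ≤ Nat.card V ^ (k - 1) * Nat.card (Quotient (Equiv.Perm.SameCycle.setoid α)) := by
  rw [← card_funSplit V i, ← Nat.card_prod]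
  have hiter : ∀ (n : ℕ) x, ∃ y, c y = c x ∧ y i = (α ^ n) (x i) := by
    intro n x
    induction n with
    | zero => exact ⟨x, rfl, rfl⟩
    | succ n ih =>
      obtain ⟨y, hy, hyi⟩ := ih
      exact ⟨φ y, (hφ y).trans hy, by rw [h, hyi, pow_succ', Equiv.Perm.mul_apply]⟩
  refine Nat.card_le_card_of_surjective
    (fun p : ({l // l ≠ i} → V) × Quotient (Equiv.Perm.SameCycle.setoid α) =>
      c ((Equiv.funSplitAt i V).symm (p.2.out, p.1))) fun a => ?_
  obtain ⟨x, rfl⟩ := hc a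
  obtain ⟨n, hn⟩ := (Equiv.Perm.SameCycle.symm (Quotient.exact
    (Quotient.out_eq (Quotient.mk (Equiv.Perm.SameCycle.setoid α) (x i))))).exists_nat_pow_eq
  obtain ⟨y, hy, hyi⟩ := hiter n x
  refine ⟨(fun l => y l, Quotient.mk _ (x i)), ?_⟩
  rw [← hy]
  refine congrArg c ?_
  rw [Equiv.symm_apply_eq]
  exact Prod.ext (by rw [← hn]; exact hyi.symm) rfl

/-- The number of colors of a coloring of a power of a connected prime graph that is preserved by
a nontrivial automorphism. -/
theorem IsCartesianPrime.card_invariant_coloring_le {V C : Type*} [Finite V] {G : SimpleGraph V}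
    (hG : G.Connected) (hprime : G.IsCartesianPrime) {k : ℕ}
    {φ : G.cartesianPower k ≃g G.cartesianPower k} (hne : φ ≠ Iso.refl)
    {c : (Fin k → V) → C} (hc : Surjective c) (hφ : ∀ x, c (φ x) = c x) :
    2 * Nat.card C ≤ Nat.card V ^ k + Nat.card V ^ (k - 1) ∨
      Nat.card C ≤ Nat.card V ^ (k - 1) * (G.distinguishingThreshold - 1) := by
  obtain ⟨σ, f, hσ, hf⟩ := hprime.exists_apply_eq hG φ
  by_cases hid : ∀ i, σ i = i
  · right
    simp only [hid] at hf
    obtain ⟨i, v, hv⟩ : ∃ i v, f i v ≠ v := by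
      by_contra! h
      exact hne (RelIso.ext fun x => funext fun i => (hf x i).trans (h i _))
    obtain ⟨v₀⟩ := hprime.1.to_nonempty
    have hoff : ∀ v w l, l ≠ i → update (fun _ => v₀) i v l = update (fun _ => v₀) i w l :=
      fun v w l hl => by simp [hl]
    have hadj : ∀ v w, G.Adj (f i v) (f i w) ↔ G.Adj v w := by
      intro v w
      have h1 := φ.map_adj_iff (v := update (fun _ => v₀) i v) (w := update (fun _ => v₀) i w)
      rw [cartesianPower_adj_iff_of_eq_off (hoff v w),
        cartesianPower_adj_iff_of_eq_off (i := i) fun l hl => by rw [hf, hf, hoff v w l hl],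
        hf, hf] at h1
      simpa using h1
    have hinj : Injective (f i) := by
      intro v w hvw
      have : φ (update (fun _ => v₀) i v) = φ (update (fun _ => v₀) i w) := by
        funext l
        rw [hf, hf]
        by_cases hl : l = i
        · subst hl; simpa using hvw
        · rw [hoff v w l hl]
      exact update_injective _ i (φ.injective this)
    let α : G ≃g G :=
      ⟨Equiv.ofBijective (f i) (Finite.injective_iff_bijective.1 hinj), hadj _ _⟩
    have hα : α ≠ Iso.refl := fun h => hv (congrArg (fun β : G ≃g G => β v) h)
    have h1 := card_le_of_coordinate_action (α := α.toEquiv) (fun x => hf x i) hc hφ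
    -- Coloring each vertex by its `α`-cycle is invariant under `α`.
    have h2 := card_lt_distinguishingThreshold
      (c := Quotient.mk (Equiv.Perm.SameCycle.setoid α.toEquiv)) Quotient.mk_surjective hα
      fun v => Quotient.sound (Equiv.Perm.sameCycle_apply_left.2 (Equiv.Perm.SameCycle.refl _ _))
    exact h1.trans (Nat.mul_le_mul_left _ (by omega))
  · left
    push Not at hid
    obtain ⟨i, hi⟩ := hid
    refine (two_mul_card_le_card_add_card_fixedPoints hc hφ).trans (Nat.add_le_add ?_ ?_)
    · rw [Nat.card_fun, Nat.card_fin]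
    · exact card_fixedPoints_le hi.symm fun x => hf x i

end Automorphisms

/-! ### Invariant colorings with many colors. -/

section LowerBounds

variable {V : Type*} [Finite V] (G : SimpleGraph V) {k : ℕ}

theorem mul_lt_distinguishingThreshold_cartesianPower [Nonempty V] (hk : 1 ≤ k) :
    Nat.card V ^ (k - 1) * (G.distinguishingThreshold - 1) <
      (G.cartesianPower k).distinguishingThreshold := by
  rcases lt_or_ge G.distinguishingThreshold 2 with h | h
  · rw [show G.distinguishingThreshold - 1 = 0 by omega, mul_zero]
    exact (distinguishingThreshold_mem (G.cartesianPower k)).1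
  obtain ⟨m, hm, c, hc, α, hα, h⟩ := exists_invariant_coloring h
  let i : Fin k := ⟨0, hk⟩
  refine lt_of_le_of_lt ?_ (card_lt_distinguishingThreshold
    (c := fun x : Fin k → V => ((fun l : {l // l ≠ i} => x l), c (x i)))
    (φ := α.cartesianPowerUpdate i) ?_ ?_ ?_)
  · rw [Nat.card_prod, card_funSplit, Nat.card_fin]
    exact Nat.mul_le_mul_left _ (by omega)
  · rintro ⟨y, a⟩
    obtain ⟨v, rfl⟩ := hc a
    refine ⟨(Equiv.funSplitAt i V).symm (v, y), ?_⟩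
    have := (Equiv.funSplitAt i V).apply_symm_apply (v, y)
    exact Prod.ext (congrArg Prod.snd this) (congrArg c (congrArg Prod.fst this))
  · intro heq
    refine hα (RelIso.ext fun v => ?_)
    have := congrFun (congrArg (fun β : G.cartesianPower k ≃g _ => β fun _ => v) heq) i
    simpa using this
  · intro x
    refine Prod.ext (funext fun l => ?_) ?_
    · simp [l.2]
    · simp [h]

theorem add_two_le_two_mul_distinguishingThreshold_cartesianPower [Nontrivial V] (hk : 2 ≤ k) :
    Nat.card V ^ k + Nat.card V ^ (k - 1) + 2 ≤
      2 * (G.cartesianPower k).distinguishingThreshold := by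
  classical
  have := Fintype.ofFinite V
  let i : Fin k := ⟨0, by omega⟩
  let j : Fin k := ⟨1, by omega⟩
  have hij : i ≠ j := by simp [i, j]
  -- The colors are the orbits of the coordinate swap: an unordered pair and the other entries.
  have key := card_lt_distinguishingThreshold (G := G.cartesianPower k)
    (c := fun x : Fin k → V => (s(x i, x j), fun l : {l // l ≠ i ∧ l ≠ j} => x l))
    (φ := G.cartesianPowerReindex (Equiv.swap i j)) ?_ ?_ ?_
  · have hcard : Nat.card {l : Fin k // l ≠ i ∧ l ≠ j} = k - 2 := by
      rw [Nat.card_eq_fintype_card, Fintype.card_subtype,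
        show Finset.univ.filter (fun l => l ≠ i ∧ l ≠ j) = ({i, j} : Finset (Fin k))ᶜ by
          ext l; simp,
        Finset.card_compl, Finset.card_pair hij, Fintype.card_fin]
    rw [Nat.card_prod, Nat.card_fun, hcard, Nat.card_eq_fintype_card (α := Sym2 V), Sym2.card,
      ← Nat.card_eq_fintype_card, Nat.choose_two_right, Nat.add_sub_cancel] at key
    set n := Nat.card V
    have h2 : 2 * ((n + 1) * n / 2) = (n + 1) * n :=
      Nat.mul_div_cancel' (by rw [mul_comm]; exact (Nat.even_mul_succ_self n).two_dvd)
    obtain ⟨k, rfl⟩ := Nat.exists_eq_add_of_le' hk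
    have h3 : n ^ (k + 2) + n ^ (k + 2 - 1) = 2 * ((n + 1) * n / 2 * n ^ (k + 2 - 2)) := by
      rw [← mul_assoc, h2, show k + 2 - 1 = k + 1 by omega, Nat.add_sub_cancel]
      ring
    omega
  · rintro ⟨p, y⟩
    induction p with | _ a b
    refine ⟨fun l => if h : l ≠ i ∧ l ≠ j then y ⟨l, h⟩ else if l = i then a else b, ?_⟩
    refine Prod.ext ?_ (funext fun l => ?_)
    · simp [hij.symm]
    · simp [l.2]
  · intro heq
    obtain ⟨v, w, hvw⟩ := exists_pair_ne V
    have := congrFun (congrArg (fun β : G.cartesianPower k ≃g _ =>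
      β (update (fun _ => v) i w)) heq) j
    simp [hij.symm, hvw.symm] at this
  · intro x
    refine Prod.ext ?_ (funext fun l => ?_)
    · simp [Sym2.eq_swap]
    · simp [Equiv.swap_apply_of_ne_of_ne l.2.1 l.2.2]

end LowerBounds

end SimpleGraph

theorem theorem4p2 {V : Type*} [Fintype V] (G : SimpleGraph V) (hconn : G.Connected)
    (hprime : G.IsCartesianPrime) (k : ℕ) (hk : 2 ≤ k) :
    ((G.cartesianPower k).distinguishingThreshold : ℚ) =
      (Fintype.card V : ℚ) ^ (k - 1) *
        max (((Fintype.card V : ℚ) + 1) / 2) ((G.distinguishingThreshold : ℚ) - 1) + 1 := by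
  have := hprime.1
  have hlow₁ := G.mul_lt_distinguishingThreshold_cartesianPower (k := k) (by omega)
  have hlow₂ := G.add_two_le_two_mul_distinguishingThreshold_cartesianPower hk
  have hθ := (SimpleGraph.distinguishingThreshold_mem G).1
  have hθk : 2 ≤ (G.cartesianPower k).distinguishingThreshold := by
    have : 0 < Nat.card V ^ k := pow_pos Nat.card_pos _
    have : 0 < Nat.card V ^ (k - 1) := pow_pos Nat.card_pos _
    omega
  obtain ⟨m, hm, c, hc, φ, hne, hφ⟩ := SimpleGraph.exists_invariant_coloring hθk
  have hup := hprime.card_invariant_coloring_le hconn hne hc hφ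
  rw [Nat.card_fin] at hup
  rw [show Nat.card V ^ k = Nat.card V ^ (k - 1) * Nat.card V by
    rw [← pow_succ, Nat.sub_add_cancel (by omega)]] at hlow₂ hup
  rw [Nat.card_eq_fintype_card] at hlow₁ hlow₂ hup
  set n := Fintype.card V
  set t := (G.cartesianPower k).distinguishingThreshold
  rw [← Nat.cast_pow]
  set N := n ^ (k - 1)
  -- Since the threshold is positive, truncated and rational subtraction of 1 agree.
  obtain ⟨r, hr⟩ := Nat.exists_eq_add_of_le' hθ
  rw [hr, Nat.add_sub_cancel] at hlow₁ hup
  rw [hr, Nat.cast_add, Nat.cast_one, add_sub_cancel_right, mul_max_of_nonneg _ _ N.cast_nonneg]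
  have hq₁ : (N : ℚ) * r + 1 ≤ t := by exact_mod_cast hlow₁
  have hq₂ : (N : ℚ) * n + N + 2 ≤ 2 * t := by exact_mod_cast hlow₂
  have hq₃ : (t : ℚ) ≤ m + 1 := by exact_mod_cast hm
  refine le_antisymm ?_ ?_
  · rcases hup with h | h
    · have h' : 2 * (m : ℚ) ≤ N * n + N := by exact_mod_cast h
      have := le_max_left ((N : ℚ) * ((n + 1) / 2)) (N * r)
      linarith
    · have h' : (m : ℚ) ≤ N * r := by exact_mod_cast h
      have := le_max_right ((N : ℚ) * ((n + 1) / 2)) (N * r)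
      linarith
  · rw [← le_sub_iff_add_le]
    exact max_le (by linarith) (by linarith)
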